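/- Let $d\ge 1$, $\alpha_i\in(1,2)$ and $d_{i,\pm}\ge 0$ with $d_{i,+}+d_{i,-}>0$ for $1\le i\le d$. Put $$t:=\max_{1\le i\le d}\frac{|d_{i,+}-d_{i,-}|}{d_{i,+}+d_{i,-}}\left|\tan\left(\frac{\alpha_i}{2}\pi\right)\right| .$$ For reals $a_i<b_i$, a time step $\tau>0$ and integers $n_i\ge1$ let $h_i=(b_i-a_i)/(n_i+1)$, $\mathbf n=(n_1,\dots,n_d)$, $n=n_1\cdots n_d$, and let $$\widetilde A_n=\frac1\tau I_n+\sum_{i=1}^d\left(\frac{d_{i,+}}{h_i^{\alpha_i}}\widetilde W_i+\frac{d_{i,-}}{h_i^{\alpha_i}}\widetilde W_i^{\top}\right),\qquad \widetilde W_i=I_{n_1\cdots n_{i-1}}\otimes\widetilde L_{n_i}^{(\alpha_i)}\otimes I_{n_{i+1}\cdots n_d},$$ be the matrix of the first-order scheme (backward Euler in time, shifted Grünwald in space) for the Riemann-Liouville fractional diffusion equation on $\prod_i(a_i,b_i)$. Here $\widetilde L_m^{(\alpha)}\in\mathbb R^{m\times m}$ has the entry $-\widetilde g^{(\alpha)}_{j-l+1}$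 at $(j,l)$ if $j-l+1\ge0$, and $0$ otherwise, with $\widetilde g^{(\alpha)}_k=(-1)^k\binom{\alpha}{k}$. Let $Y_n=Y_{n_1}\otimes\cdots\otimes Y_{n_d}$, where $Y_m$ is the $m\times m$ anti-identity matrix, and let $\mathcal H=\mathcal H(\widetilde A_n)=(\widetilde A_n+\widetilde A_n^\top)/2$. There is a number $\varepsilon$ depending only on $d$, $(\alpha_i)$, $(d_{i,\pm})$, with $0<\varepsilon<t$ if $t>0$ and $\varepsilon=0$ if $t=0$, such that for $\omega:=\sqrt{\varepsilon/(2+\varepsilon)}$ (so that $\omega\in(0,1)$ if $t>0$) and for all $a_i<b_i$, $\tau>0$ and $\mathbf n$ the following hold. 1. $\mathcal H$ is symmetric positive definite and $Y_n\widetilde A_n$ is symmetric. 2. All (complex) eigenvalues of $\mathcal H^{-1}Y_n\widetilde A_n$ are real and lie in $[-(1+\varepsilon),-1]\cup[1,1+\varepsilon]$. 3. MINRES with preconditioner $\mathcal H$ for $Y_n\widetilde A_n\mathbf x=Y_n\mathbf b$ has a convergence rate independent of $\mathbf n$. That is, for every right-hand side $\mathbf b\in\mathbb R^n$, every initial guess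 $\mathbf u^{(0)}$ and every $k\ge0$, the preconditioned residual $\mathbf r^{(k)}=\mathcal H^{-1}Y_n\mathbf b-\mathcal H^{-1}Y_n\widetilde A_n\mathbf u^{(k)}$ satisfies $$\|\mathbf r^{(k)}\|_{\mathcal H}\le 2\,\omega^{2\lfloor k/2\rfloor}\,\|\mathbf r^{(0)}\|_{\mathcal H},\qquad \|\mathbf r\|_{\mathcal H}:=\sqrt{\mathbf r^\top\mathcal H\mathbf r}=\|\mathcal H^{1/2}\mathbf r\|_2 .$$ Here the $k$-th MINRES iterate $\mathbf u^{(k)}$ is the vector of $\mathbf u^{(0)}+\mathrm{span}\{(\mathcal H^{-1}Y_n\widetilde A_n)^j\mathbf r^{(0)}:0\le j<k\}$ whose preconditioned residual has the smallest norm $\|\cdot\|_{\mathcal H}$; this norm equals $\|\mathcal H^{-1/2}(Y_n\mathbf b-Y_n\widetilde A_n\mathbf u^{(k)})\|_2$. (For $\omega=0$, $\omega^0=1$.) -/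

import Mathlib

namespace FirstOrderScheme

noncomputable section

/-- Multi-indices of the grid with `n i` interior points in direction `i`. Real `n × n` matrices,
`n = n_1 ⋯ n_d`, and vectors of length `n` are indexed by multi-indices. -/
abbrev Grid {d : ℕ} (n : Fin d → ℕ) : Type := (i : Fin d) → Fin (n i)

/-- The Kronecker product `M_1 ⊗ ⋯ ⊗ M_d`, with rows and columns indexed by multi-indices. -/
def kroneckerProd {d : ℕ} {n : Fin d → ℕ} (M : (i : Fin d) → Matrix (Fin (n i)) (Fin (n i)) ℝ) :
    Matrix (Grid n) (Grid n) ℝ :=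
  Matrix.of fun j l => ∏ i, M i (j i) (l i)

/-- `I ⊗ B ⊗ I`, the matrix `B` acting in direction `i` and the identity in the others. -/
def inDirection {d : ℕ} {n : Fin d → ℕ} (i : Fin d) (B : Matrix (Fin (n i)) (Fin (n i)) ℝ) :
    Matrix (Grid n) (Grid n) ℝ :=
  kroneckerProd (Function.update (fun _ => 1) i B)

/-- The anti-identity matrix `Y_m`: ones exactly at the entries `(j, l)` with `j + l = m + 1`
for indices starting from `1`, i.e. `j + l + 1 = m` for indices starting from `0`. -/
def antiIdentity (m : ℕ) : Matrix (Fin m) (Fin m) ℝ :=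
  Matrix.of fun j l => if (j : ℕ) + (l : ℕ) + 1 = m then 1 else 0

/-- The multilevel anti-identity `Y_n = Y_{n_1} ⊗ ⋯ ⊗ Y_{n_d}`. -/
def multiAntiIdentity {d : ℕ} (n : Fin d → ℕ) : Matrix (Grid n) (Grid n) ℝ :=
  kroneckerProd fun i => antiIdentity (n i)

/-- The Grünwald coefficient `(-1)^k α (α - 1) ⋯ (α - k + 1) / k!`. -/
def grunwaldCoeff (α : ℝ) (k : ℕ) : ℝ :=
  (-1) ^ k / (k.factorial : ℝ) * ∏ m ∈ Finset.range k, (α - (m : ℝ))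

/-- The shifted Grünwald matrix: the entry `(j, l)` is minus the Grünwald coefficient of index
`j - l + 1` if this index is nonnegative, and `0` otherwise. -/
def grunwaldMatrix (α : ℝ) (m : ℕ) : Matrix (Fin m) (Fin m) ℝ :=
  Matrix.of fun j l =>
    if (l : ℕ) ≤ (j : ℕ) + 1 then - grunwaldCoeff α ((j : ℕ) + 1 - (l : ℕ)) else 0

/-- The step size `h_i = (b_i - a_i) / (n_i + 1)`. -/
def stepSize {d : ℕ} (a b : Fin d → ℝ) (n : Fin d → ℕ) (i : Fin d) : ℝ :=
  (b i - a i) / ((n i : ℝ) + 1)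

/-- The coefficient matrix of the first-order scheme (backward Euler in time with step `τ`, shifted
Grünwald in space) for the fractional diffusion equation with orders `α` and diffusion
coefficients `dp`, `dm` (left and right) on the box with corners `a`, `b`. -/
def schemeMatrix {d : ℕ} (α dp dm : Fin d → ℝ) (τ : ℝ) (a b : Fin d → ℝ) (n : Fin d → ℕ) :
    Matrix (Grid n) (Grid n) ℝ :=
  (1 / τ) • (1 : Matrix (Grid n) (Grid n) ℝ) +
    ∑ i, ((dp i / stepSize a b n i ^ α i) • inDirection i (grunwaldMatrix (α i) (n i)) +
      (dm i / stepSize a b n i ^ α i) •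
        (inDirection i (grunwaldMatrix (α i) (n i))).transpose)

/-- The symmetric part `(Z + Zᵀ) / 2`. -/
def symmPart {ι : Type*} (Z : Matrix ι ι ℝ) : Matrix ι ι ℝ :=
  (1 / 2 : ℝ) • (Z + Z.transpose)

/-- The norm `√(rᵀ P r)` defined by a symmetric positive definite matrix `P`. -/
def energyNorm {ι : Type*} [Fintype ι] (P : Matrix ι ι ℝ) (r : ι → ℝ) : ℝ :=
  Real.sqrt (dotProduct r (P.mulVec r))

/-- The residual `P⁻¹ c - P⁻¹ K u` of `u` in the preconditioned system `P⁻¹ K x = P⁻¹ c`. -/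
def precondResidual {ι : Type*} [Fintype ι] [DecidableEq ι] (P K : Matrix ι ι ℝ)
    (c u : ι → ℝ) : ι → ℝ :=
  P⁻¹.mulVec c - (P⁻¹ * K).mulVec u

/-- The Krylov space spanned by `z, M z, …, M^(k-1) z`. -/
def krylov {ι : Type*} [Fintype ι] [DecidableEq ι] (M : Matrix ι ι ℝ) (z : ι → ℝ) (k : ℕ) :
    Submodule ℝ (ι → ℝ) :=
  Submodule.span ℝ (Set.range fun j : Fin k => (M ^ (j : ℕ)).mulVec z)

/-- `u` is the `k`-th iterate of the MINRES method for `K x = c` (`K` symmetric) with symmetric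
positive definite preconditioner `P` and initial guess `u₀`: among all vectors of
`u₀ + span {z, (P⁻¹ K) z, …, (P⁻¹ K)^(k-1) z}`, where `z` is the initial preconditioned residual,
it minimizes the norm `√(rᵀ P r) = ‖P^(-1/2) (c - K u)‖₂` of the preconditioned residual `r`. -/
def IsMinresIterate {ι : Type*} [Fintype ι] [DecidableEq ι] (P K : Matrix ι ι ℝ)
    (c u₀ : ι → ℝ) (k : ℕ) (u : ι → ℝ) : Prop :=
  u - u₀ ∈ krylov (P⁻¹ * K) (precondResidual P K c u₀) k ∧
    ∀ v : ι → ℝ, v - u₀ ∈ krylov (P⁻¹ * K) (precondResidual P K c u₀) k →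
      energyNorm P (precondResidual P K c u) ≤ energyNorm P (precondResidual P K c v)

/-- `max_i |d_{i,+} - d_{i,-}| / (d_{i,+} + d_{i,-}) * |tan (α_i π / 2)|`, a maximum over a
nonempty finite set when `0 < d`. -/
def asymmetryBound {d : ℕ} (α dp dm : Fin d → ℝ) : ℝ :=
  ⨆ i, |dp i - dm i| / (dp i + dm i) * |Real.tan (α i / 2 * Real.pi)|

/-- The convergence rate `ω = √(ε / (2 + ε))`. -/
def rate (ε : ℝ) : ℝ := Real.sqrt (ε / (2 + ε))

end

end FirstOrderScheme

/-! The shifted Grünwald matrix is the Toeplitz matrix of the symbol `-e^{-iθ} (1 - e^{iθ})^α`,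
which equals `(2 sin (θ/2))^α e^{i(π-θ)(1-α/2)}` for `0 < θ < 2π`. Its argument is at most `π(1-α/2)
< π/2` in modulus, so the symbol, and with it the numerical range of the matrix, lies in the sector
`|Im z| ≤ |tan(απ/2)| Re z`. Transposition flips the imaginary part; hence direction `i` of the
scheme keeps only the fraction `|d₊ - d₋| / (d₊ + d₋)` of that slope, and `A` is sectorial with
slope `t` (`hasSectorialForm_schemeMatrix`).

Write `A = H + S` with `S` skew. Since `Y A Y = Aᵀ`, the flip `Y` commutes with `H`, and `H^{-1/2} Y
A H^{-1/2}` is the orthogonal `Y` times `I + H^{-1/2} S H^{-1/2}`. It is symmetric, so the moduli of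
its eigenvalues are its singular values `√(1 + s²)`, where `±is` are eigenvalues of the skew matrix
and `|s| ≤ t` by sectoriality. Thus `1 ≤ μ² ≤ 1 + t²`, which `sq_bounds_of_flipped_eigenvector`
proves without square roots of matrices, and `ε = √(1 + t²) - 1`.

The MINRES rate follows by testing minimality with a Chebyshev polynomial in `μ²`
(`energyNorm_minres_le`, `exists_poly_small_on_symmetric_intervals`). -/

namespace FirstOrderScheme

/-! ### Grünwald coefficients as Fourier coefficients -/

theorem grunwaldCoeff_eq_choose (α : ℝ) (k : ℕ) :
    grunwaldCoeff α k = (-1) ^ k * Ring.choose α k := by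
  have h : ∏ m ∈ Finset.range k, (α - (m : ℝ)) = (descPochhammer ℤ k).smeval α := by
    induction k with
    | zero => simp [Polynomial.smeval_one]
    | succ k ih =>
      rw [Finset.prod_range_succ, ih, descPochhammer_succ_right, Polynomial.smeval_mul,
        Polynomial.smeval_sub]
      simp [Polynomial.smeval_natCast, Polynomial.smeval_X]
  rw [grunwaldCoeff, Ring.choose_eq_smul, h, smul_eq_mul]
  ring

theorem hasSum_grunwaldCoeff_mul_pow (α : ℝ) {z : ℂ} (hz : ‖z‖ < 1) :
    HasSum (fun k => (grunwaldCoeff α k : ℂ) * z ^ k) ((1 - z) ^ (α : ℂ)) := by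
  have h := (Complex.one_add_cpow_hasFPowerSeriesOnBall_zero (a := (α : ℂ))).hasSum
    (y := -z) (by simpa [← ofReal_norm] using hz)
  simp only [binomialSeries_apply, List.ofFn_const, List.prod_replicate, smul_eq_mul,
    zero_sub, ← sub_eq_add_neg] at h
  refine h.congr_fun fun k => ?_
  rw [grunwaldCoeff_eq_choose, neg_pow z]
  push_cast [Complex.ofReal_choose]
  ring

theorem integral_exp_int_mul_I (n : ℤ) :
    ∫ θ in (0 : ℝ)..2 * Real.pi, Complex.exp (n * θ * Complex.I) =
      if n = 0 then 2 * (Real.pi : ℂ) else 0 := by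
  split_ifs with h
  · simp [h]
  · have hc : (n : ℂ) * Complex.I ≠ 0 := by simp [h]
    have := integral_exp_mul_complex (a := 0) (b := 2 * Real.pi) hc
    have e : Complex.exp (n * Complex.I * ((2 * Real.pi : ℝ) : ℂ)) = 1 := by
      rw [Complex.exp_eq_one_iff]
      exact ⟨n, by push_cast; ring⟩
    rw [e] at this
    simp only [Complex.ofReal_zero, mul_zero, Complex.exp_zero, sub_self, zero_div] at this
    rw [← this]
    congr 1
    ext θ
    congr 1
    ring

theorem norm_real_mul_exp_I {r : ℝ} (hr : 0 ≤ r) (θ : ℝ) :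
    ‖(r : ℂ) * Complex.exp (θ * Complex.I)‖ = r := by
  rw [norm_mul, Complex.norm_exp_ofReal_mul_I, Complex.norm_real, Real.norm_of_nonneg hr, mul_one]

/-- Inside the unit disc the binomial series converges absolutely and uniformly on the circle of
radius `r`, so it may be integrated term by term; only the term `k = -n` survives. -/
theorem integral_cpow_mul_exp_of_lt_one (α : ℝ) {r : ℝ} (hr : 0 ≤ r) (hr1 : r < 1) (n : ℤ) :
    ∫ θ in (0 : ℝ)..2 * Real.pi,
        (1 - r * Complex.exp (θ * Complex.I)) ^ (α : ℂ) * Complex.exp (n * θ * Complex.I) =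
      2 * Real.pi * (if n ≤ 0 then (grunwaldCoeff α n.natAbs : ℂ) * r ^ n.natAbs else 0) := by
  have hs : Summable fun k => |grunwaldCoeff α k| * r ^ k := by
    have := (hasSum_grunwaldCoeff_mul_pow α (z := (r : ℂ))
      (by simpa [abs_of_nonneg hr] using hr1)).summable.norm
    simpa [abs_of_nonneg hr] using this
  have key := intervalIntegral.hasSum_integral_of_dominated_convergence
    (μ := MeasureTheory.volume) (a := 0) (b := 2 * Real.pi)
    (F := fun (k : ℕ) (θ : ℝ) => (grunwaldCoeff α k : ℂ) *
      (r * Complex.exp (θ * Complex.I)) ^ k * Complex.exp (n * θ * Complex.I))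
    (f := fun θ : ℝ => (1 - r * Complex.exp (θ * Complex.I)) ^ (α : ℂ) *
      Complex.exp (n * θ * Complex.I))
    (fun k _ => |grunwaldCoeff α k| * r ^ k)
    (fun k => Continuous.aestronglyMeasurable (by fun_prop))
    (fun k => Filter.Eventually.of_forall fun θ _ => by
      have : ‖Complex.exp (n * θ * Complex.I)‖ = 1 := by
        have := Complex.norm_exp_ofReal_mul_I (n * θ)
        push_cast at this
        exact this
      rw [norm_mul, norm_mul, norm_pow, norm_real_mul_exp_I hr, this, Complex.norm_real,
        mul_one, Real.norm_eq_abs])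
    (Filter.Eventually.of_forall fun θ _ => hs)
    (by simp)
    (Filter.Eventually.of_forall fun θ _ =>
      (hasSum_grunwaldCoeff_mul_pow α (by rwa [norm_real_mul_exp_I hr])).mul_right _)
  have hI : ∀ k : ℕ, ∫ θ in (0 : ℝ)..2 * Real.pi, (grunwaldCoeff α k : ℂ) *
      (r * Complex.exp (θ * Complex.I)) ^ k * Complex.exp (n * θ * Complex.I) =
      (grunwaldCoeff α k : ℂ) * r ^ k * if (k : ℤ) + n = 0 then 2 * (Real.pi : ℂ) else 0 := by
    intro k
    rw [← integral_exp_int_mul_I, ← intervalIntegral.integral_const_mul]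
    congr 1
    ext θ
    rw [mul_pow, ← Complex.exp_nat_mul, ← mul_assoc, mul_assoc, ← Complex.exp_add]
    push_cast
    ring_nf
  simp only [hI] at key
  refine key.unique ?_
  split_ifs with hn
  · obtain ⟨m, rfl⟩ : ∃ m : ℕ, n = -m := ⟨n.natAbs, by omega⟩
    convert hasSum_single m _ using 1
    · simp [mul_comm]
    · intro k hk
      rw [if_neg (by omega), mul_zero]
  · convert hasSum_zero using 2 with k
    · rw [if_neg (by omega), mul_zero]
    · simp

theorem one_sub_exp_I_re_nonneg (θ : ℝ) : 0 ≤ (1 - Complex.exp (θ * Complex.I)).re := by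
  simp [Complex.exp_ofReal_mul_I_re, Real.cos_le_one]

theorem continuous_one_sub_exp_cpow {α : ℝ} (hα : 0 < α) :
    Continuous fun θ : ℝ => (1 - Complex.exp (θ * Complex.I)) ^ (α : ℂ) := by
  rw [continuous_iff_continuousAt]
  intro θ
  exact (Complex.continuousAt_cpow_const_of_re_pos (Or.inl (one_sub_exp_I_re_nonneg θ))
    (by simpa using hα)).comp
    (f := fun θ : ℝ => 1 - Complex.exp (θ * Complex.I)) (x := θ) (by fun_prop)

/-- Limit `r → 1` from below, dominated by `2^α`. The base may reach the branch point `0`, where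
continuity of the power needs `α > 0`. -/
theorem integral_cpow_mul_exp {α : ℝ} (hα : 0 < α) (n : ℤ) :
    ∫ θ in (0 : ℝ)..2 * Real.pi,
        (1 - Complex.exp (θ * Complex.I)) ^ (α : ℂ) * Complex.exp (n * θ * Complex.I) =
      2 * Real.pi * (if n ≤ 0 then (grunwaldCoeff α n.natAbs : ℂ) else 0) := by
  have hev : ∀ᶠ r : ℝ in nhdsWithin 1 (Set.Iio 1), 0 ≤ r ∧ r < 1 := by
    filter_upwards [Ioo_mem_nhdsLT (show (0 : ℝ) < 1 by norm_num)] with r hr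
    exact ⟨hr.1.le, hr.2⟩
  have h1 := intervalIntegral.tendsto_integral_filter_of_dominated_convergence
    (μ := MeasureTheory.volume) (a := 0) (b := 2 * Real.pi)
    (l := nhdsWithin (1 : ℝ) (Set.Iio 1))
    (F := fun (r : ℝ) (θ : ℝ) => (1 - r * Complex.exp (θ * Complex.I)) ^ (α : ℂ) *
      Complex.exp (n * θ * Complex.I))
    (f := fun θ : ℝ => (1 - Complex.exp (θ * Complex.I)) ^ (α : ℂ) *
      Complex.exp (n * θ * Complex.I))
    (fun _ => (2 : ℝ) ^ α)
    (by
      filter_upwards [hev] with r hr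
      refine Continuous.aestronglyMeasurable (Continuous.mul ?_ (by fun_prop))
      refine Continuous.cpow (by fun_prop) (by fun_prop) fun θ => Or.inl ?_
      have := Complex.re_le_norm ((r : ℂ) * Complex.exp (θ * Complex.I))
      rw [norm_real_mul_exp_I hr.1] at this
      simp only [Complex.sub_re, Complex.one_re]
      linarith [hr.2])
    (by
      filter_upwards [hev] with r hr
      refine Filter.Eventually.of_forall fun θ _ => ?_
      have : ‖Complex.exp (n * θ * Complex.I)‖ = 1 := by
        have := Complex.norm_exp_ofReal_mul_I (n * θ)
        push_cast at this
        exact this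
      rw [norm_mul, this, mul_one, Complex.norm_cpow_real]
      refine Real.rpow_le_rpow (norm_nonneg _) ?_ hα.le
      refine (norm_sub_le _ _).trans ?_
      rw [norm_real_mul_exp_I hr.1, norm_one]
      linarith [hr.2])
    (by simp)
    (Filter.Eventually.of_forall fun θ _ => by
      refine Filter.Tendsto.mul_const _ ?_
      have hc : ContinuousAt (fun r : ℝ => (1 - r * Complex.exp (θ * Complex.I)) ^ (α : ℂ)) 1 := by
        refine ContinuousAt.comp (g := fun w : ℂ => w ^ (α : ℂ))
          (f := fun r : ℝ => 1 - r * Complex.exp (θ * Complex.I)) ?_ (by fun_prop)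
        simpa using Complex.continuousAt_cpow_const_of_re_pos
          (Or.inl (one_sub_exp_I_re_nonneg θ)) (by simpa using hα)
      have := hc.tendsto
      simp only [Complex.ofReal_one, one_mul] at this
      exact this.mono_left nhdsWithin_le_nhds)
  refine tendsto_nhds_unique h1 ?_
  have h2 : Filter.Tendsto (fun r : ℝ => 2 * (Real.pi : ℂ) *
      (if n ≤ 0 then (grunwaldCoeff α n.natAbs : ℂ) * r ^ n.natAbs else 0))
      (nhdsWithin 1 (Set.Iio 1))
      (nhds (2 * Real.pi * (if n ≤ 0 then (grunwaldCoeff α n.natAbs : ℂ) else 0))) := by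
    have : Continuous fun r : ℝ => 2 * (Real.pi : ℂ) *
        (if n ≤ 0 then (grunwaldCoeff α n.natAbs : ℂ) * r ^ n.natAbs else 0) := by
      split_ifs <;> fun_prop
    have := this.tendsto 1
    simp only [Complex.ofReal_one, one_pow, mul_one] at this
    exact this.mono_left nhdsWithin_le_nhds
  refine h2.congr' ?_
  filter_upwards [hev] with r hr
  exact (integral_cpow_mul_exp_of_lt_one α hr.1 hr.2 n).symm

/-! ### The symbol and its sector -/

/-- The symbol `-e^{-iθ} (1 - e^{iθ})^α` of the shifted Grünwald matrices. -/
noncomputable def grunwaldSymbol (α θ : ℝ) : ℂ :=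
  -((1 - Complex.exp (θ * Complex.I)) ^ (α : ℂ) * Complex.exp (-θ * Complex.I))

/-- Polar form: `1 - e^{iθ} = 2 sin(θ/2) e^{i(θ-π)/2}` has argument in `(-π/2, π/2)`, so the
principal power just multiplies it by `α`. -/
theorem grunwaldSymbol_eq {α θ : ℝ} (h0 : 0 < θ) (h1 : θ < 2 * Real.pi) :
    grunwaldSymbol α θ = ((2 * Real.sin (θ / 2)) ^ α : ℝ) *
      Complex.exp (((Real.pi - θ) * (1 - α / 2) : ℝ) * Complex.I) := by
  have hs : 0 < 2 * Real.sin (θ / 2) := by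
    have := Real.sin_pos_of_pos_of_lt_pi (x := θ / 2) (by linarith) (by linarith)
    linarith
  have hpol : 1 - Complex.exp (θ * Complex.I) = ((2 * Real.sin (θ / 2) : ℝ) : ℂ) *
      Complex.exp (((θ - Real.pi) / 2 : ℝ) * Complex.I) := by
    rw [Complex.exp_mul_I, Complex.exp_mul_I, ← Complex.ofReal_cos, ← Complex.ofReal_sin,
      ← Complex.ofReal_cos, ← Complex.ofReal_sin]
    have e1 : Real.cos ((θ - Real.pi) / 2) = Real.sin (θ / 2) := by
      rw [← Real.cos_pi_div_two_sub, ← Real.cos_neg]; congr 1; ring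
    have e2 : Real.sin ((θ - Real.pi) / 2) = -Real.cos (θ / 2) := by
      rw [← Real.sin_pi_div_two_sub, ← Real.sin_neg]; congr 1; ring
    have e3 : Real.cos θ = 1 - 2 * Real.sin (θ / 2) ^ 2 := by
      have := Real.cos_two_mul (θ / 2)
      rw [mul_div_cancel₀ θ two_ne_zero] at this
      nlinarith [Real.sin_sq_add_cos_sq (θ / 2)]
    have e4 : Real.sin θ = 2 * Real.sin (θ / 2) * Real.cos (θ / 2) := by
      rw [← Real.sin_two_mul]; congr 1; ring
    rw [e1, e2, e3, e4]
    push_cast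
    ring
  have hmul : (((2 * Real.sin (θ / 2) : ℝ) : ℂ) *
      Complex.exp (((θ - Real.pi) / 2 : ℝ) * Complex.I)) ^ (α : ℂ) =
      ((2 * Real.sin (θ / 2) : ℝ) : ℂ) ^ (α : ℂ) *
        Complex.exp (((θ - Real.pi) / 2 * α : ℝ) * Complex.I) := by
    have hne : ((2 * Real.sin (θ / 2) : ℝ) : ℂ) ≠ 0 := Complex.ofReal_ne_zero.mpr hs.ne'
    rw [Complex.cpow_def_of_ne_zero (mul_ne_zero hne (Complex.exp_ne_zero _)),
      Complex.log_ofReal_mul hs (Complex.exp_ne_zero _), Complex.log_exp,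
      Complex.cpow_def_of_ne_zero hne, ← Complex.exp_add, Complex.ofReal_log hs.le]
    · push_cast; ring_nf
    · simp; linarith
    · simp; linarith
  rw [grunwaldSymbol, hpol, hmul, ← Complex.ofReal_cpow hs.le, mul_assoc,
    ← Complex.exp_add, ← mul_neg]
  congr 1
  -- The sign is absorbed as `e^{iπ}`: `(θ-π)α/2 - θ + π = (π-θ)(1-α/2)`.
  rw [← mul_neg_one, ← Complex.exp_pi_mul_I, ← Complex.exp_add]
  push_cast
  ring_nf

theorem abs_tan_eq {α : ℝ} (hα : 1 < α ∧ α < 2) :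
    |Real.tan (α / 2 * Real.pi)| = Real.tan (Real.pi * (1 - α / 2)) := by
  have hpi := Real.pi_pos
  have h : Real.tan (α / 2 * Real.pi) = -Real.tan (Real.pi * (1 - α / 2)) := by
    rw [← Real.tan_neg, ← Real.tan_sub_pi]
    congr 1; ring
  rw [h, abs_neg, abs_of_nonneg]
  exact Real.tan_nonneg_of_nonneg_of_le_pi_div_two (by nlinarith [hα.2]) (by nlinarith [hα.1])

theorem abs_im_grunwaldSymbol_le {α θ : ℝ} (hα : 1 < α ∧ α < 2) (h0 : 0 < θ)
    (h1 : θ < 2 * Real.pi) :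
    0 ≤ (grunwaldSymbol α θ).re ∧ |(grunwaldSymbol α θ).im| ≤
      |Real.tan (α / 2 * Real.pi)| * (grunwaldSymbol α θ).re := by
  have hpi := Real.pi_pos
  rw [grunwaldSymbol_eq h0 h1, Complex.re_ofReal_mul, Complex.im_ofReal_mul,
    Complex.exp_ofReal_mul_I_re, Complex.exp_ofReal_mul_I_im, abs_tan_eq hα]
  set R := (2 * Real.sin (θ / 2)) ^ α
  have hR : 0 ≤ R := Real.rpow_nonneg (by
    have := Real.sin_nonneg_of_nonneg_of_le_pi (x := θ / 2) (by linarith) (by linarith)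
    linarith) _
  set β := Real.pi * (1 - α / 2) with hβ
  set φ := (Real.pi - θ) * (1 - α / 2) with hφ
  have hβ2 : β < Real.pi / 2 := by nlinarith [hα.1]
  have hφ1 : φ ≤ β := by nlinarith [hα.2]
  have hφ2 : -β ≤ φ := by nlinarith [hα.2]
  have hcβ : 0 < Real.cos β := Real.cos_pos_of_mem_Ioo ⟨by linarith, hβ2⟩
  have hcφ : 0 ≤ Real.cos φ := Real.cos_nonneg_of_mem_Icc ⟨by linarith, by linarith⟩
  refine ⟨mul_nonneg hR hcφ, ?_⟩
  -- For `|φ| ≤ β`, the bound `|sin φ| ≤ tan β cos φ` is `sin(β ± φ) ≥ 0` divided by `cos β`.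
  have hm := Real.sin_nonneg_of_nonneg_of_le_pi (x := β - φ) (by linarith) (by linarith)
  have hp := Real.sin_nonneg_of_nonneg_of_le_pi (x := β + φ) (by linarith) (by linarith)
  rw [Real.sin_sub] at hm
  rw [Real.sin_add] at hp
  have key : |Real.sin φ| ≤ Real.tan β * Real.cos φ := by
    rw [Real.tan_eq_sin_div_cos, div_mul_eq_mul_div, abs_le, ← neg_div, div_le_iff₀ hcβ,
      le_div_iff₀ hcβ]
    constructor <;> linarith
  rw [abs_mul, abs_of_nonneg hR]
  calc R * |Real.sin φ| ≤ R * (Real.tan β * Real.cos φ) := by gcongr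
    _ = _ := by ring

theorem continuous_grunwaldSymbol {α : ℝ} (hα : 0 < α) : Continuous (grunwaldSymbol α) :=
  ((continuous_one_sub_exp_cpow hα).mul (by fun_prop)).neg

theorem integral_grunwaldSymbol_mul_exp {α : ℝ} (hα : 0 < α) {m : ℕ} (j l : Fin m) :
    ∫ θ in (0 : ℝ)..2 * Real.pi,
        grunwaldSymbol α θ * Complex.exp (((l : ℕ) - (j : ℕ) : ℤ) * θ * Complex.I) =
      2 * Real.pi * (grunwaldMatrix α m j l : ℂ) := by
  have h := integral_cpow_mul_exp hα ((l : ℕ) - (j : ℕ) - 1 : ℤ)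
  have e : ∀ θ : ℝ, grunwaldSymbol α θ *
      Complex.exp (((l : ℕ) - (j : ℕ) : ℤ) * θ * Complex.I) =
      -((1 - Complex.exp (θ * Complex.I)) ^ (α : ℂ) *
        Complex.exp (((l : ℕ) - (j : ℕ) - 1 : ℤ) * θ * Complex.I)) := by
    intro θ
    rw [grunwaldSymbol, neg_mul, mul_assoc, ← Complex.exp_add]
    push_cast
    ring_nf
  simp only [e]
  rw [intervalIntegral.integral_neg, h, grunwaldMatrix, Matrix.of_apply, ← mul_neg]
  congr 1
  by_cases hjl : (l : ℕ) ≤ (j : ℕ) + 1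
  · rw [if_pos (by omega), if_pos hjl,
      show ((l : ℕ) - (j : ℕ) - 1 : ℤ).natAbs = (j : ℕ) + 1 - (l : ℕ) by omega]
    simp
  · rw [if_neg (by omega), if_neg hjl]
    simp

/-! ### Numerical range of the Grünwald matrix -/

/-- The trigonometric polynomial with coefficients `z`. -/
noncomputable def trigPoly {m : ℕ} (z : Fin m → ℂ) (θ : ℝ) : ℂ :=
  ∑ l, z l * Complex.exp ((l : ℕ) * θ * Complex.I)

theorem continuous_trigPoly {m : ℕ} (z : Fin m → ℂ) : Continuous (trigPoly z) := by
  unfold trigPoly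
  fun_prop

theorem normSq_trigPoly {m : ℕ} (z : Fin m → ℂ) (θ : ℝ) :
    (Complex.normSq (trigPoly z θ) : ℂ) = ∑ j, ∑ l, (starRingEnd ℂ) (z j) * z l *
      Complex.exp (((l : ℕ) - (j : ℕ) : ℤ) * θ * Complex.I) := by
  rw [Complex.normSq_eq_conj_mul_self, trigPoly, map_sum, Finset.sum_mul_sum]
  refine Finset.sum_congr rfl fun j _ => Finset.sum_congr rfl fun l _ => ?_
  rw [map_mul, ← Complex.exp_conj, mul_mul_mul_comm, ← Complex.exp_add]
  simp only [map_mul, Complex.conj_I, Complex.conj_ofReal, map_natCast]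
  push_cast
  ring_nf

theorem integral_grunwaldSymbol_mul_normSq {α : ℝ} (hα : 0 < α) {m : ℕ} (z : Fin m → ℂ) :
    ∫ θ in (0 : ℝ)..2 * Real.pi, grunwaldSymbol α θ * (Complex.normSq (trigPoly z θ) : ℂ) =
      2 * Real.pi * ∑ j, ∑ l, (starRingEnd ℂ) (z j) * z l * (grunwaldMatrix α m j l : ℂ) := by
  have hc := continuous_grunwaldSymbol hα
  simp only [normSq_trigPoly, Finset.mul_sum]
  rw [intervalIntegral.integral_finsetSum fun j _ => Continuous.intervalIntegrable (by fun_prop) _ _]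
  refine Finset.sum_congr rfl fun j _ => ?_
  rw [intervalIntegral.integral_finsetSum fun j _ => Continuous.intervalIntegrable (by fun_prop) _ _]
  refine Finset.sum_congr rfl fun l _ => ?_
  rw [mul_left_comm, ← integral_grunwaldSymbol_mul_exp hα, ← intervalIntegral.integral_const_mul]
  congr 1
  ext θ
  ring

theorem re_mul_integral_nonneg {F : ℝ → ℂ} (hF : Continuous F) {c : ℂ} {a b : ℝ} (hab : a ≤ b)
    (h : ∀ θ ∈ Set.Ioo a b, 0 ≤ (c * F θ).re) : 0 ≤ (c * ∫ θ in a..b, F θ).re := by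
  rw [← intervalIntegral.integral_const_mul]
  have := Complex.reCLM.intervalIntegral_comp_comm
    (f := fun θ => c * F θ) (a := a) (b := b) (μ := MeasureTheory.volume)
    (Continuous.intervalIntegrable (by fun_prop) _ _)
  simp only [Complex.reCLM_apply] at this
  rw [← this, intervalIntegral.integral_of_le hab, MeasureTheory.integral_Ioc_eq_integral_Ioo]
  exact MeasureTheory.setIntegral_nonneg measurableSet_Ioo h

open Matrix in
theorem sum_conj_mul_mul {ι : Type*} [Fintype ι] (B : Matrix ι ι ℝ) (x y : ι → ℝ) :
    ∑ j, ∑ l, (starRingEnd ℂ) (x j + y j * Complex.I) * (x l + y l * Complex.I) * (B j l : ℂ) =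
      ((x ⬝ᵥ B *ᵥ x + y ⬝ᵥ B *ᵥ y : ℝ) : ℂ) + ((x ⬝ᵥ B *ᵥ y - y ⬝ᵥ B *ᵥ x : ℝ) : ℂ) * Complex.I := by
  simp only [dotProduct, mulVec, Finset.mul_sum]
  push_cast
  rw [← Finset.sum_add_distrib, ← Finset.sum_sub_distrib, Finset.sum_mul,
    ← Finset.sum_add_distrib]
  refine Finset.sum_congr rfl fun j _ => ?_
  rw [← Finset.sum_add_distrib, ← Finset.sum_sub_distrib, Finset.sum_mul,
    ← Finset.sum_add_distrib]
  refine Finset.sum_congr rfl fun l _ => ?_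
  simp only [map_add, map_mul, Complex.conj_ofReal, Complex.conj_I]
  linear_combination (-(y j : ℂ) * y l * B j l) * Complex.I_sq

open Matrix in
-- The form at `x + iy` is, up to `2π`, the integral of the symbol against the nonnegative weight
-- `|trigPoly|²`. The sector is an intersection of half-planes `Re (c z) ≥ 0`, with `c = 1`, `T -
-- i`, `T + i`, and each half-plane is preserved by such integrals.
theorem grunwaldMatrix_form_bound {α : ℝ} (hα : 1 < α ∧ α < 2) {m : ℕ} (x y : Fin m → ℝ) :
    0 ≤ x ⬝ᵥ grunwaldMatrix α m *ᵥ x + y ⬝ᵥ grunwaldMatrix α m *ᵥ y ∧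
    |x ⬝ᵥ grunwaldMatrix α m *ᵥ y - y ⬝ᵥ grunwaldMatrix α m *ᵥ x| ≤
      |Real.tan (α / 2 * Real.pi)| *
        (x ⬝ᵥ grunwaldMatrix α m *ᵥ x + y ⬝ᵥ grunwaldMatrix α m *ᵥ y) := by
  have hα0 : 0 < α := by linarith [hα.1]
  have hpi := Real.pi_pos
  set z : Fin m → ℂ := fun j => x j + y j * Complex.I with hz
  have hF : Continuous fun θ => grunwaldSymbol α θ * (Complex.normSq (trigPoly z θ) : ℂ) :=
    (continuous_grunwaldSymbol hα0).mul
      (Complex.continuous_ofReal.comp (Complex.continuous_normSq.comp (continuous_trigPoly z)))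
  set T := |Real.tan (α / 2 * Real.pi)|
  set p := x ⬝ᵥ grunwaldMatrix α m *ᵥ x + y ⬝ᵥ grunwaldMatrix α m *ᵥ y
  set q := x ⬝ᵥ grunwaldMatrix α m *ᵥ y - y ⬝ᵥ grunwaldMatrix α m *ᵥ x
  have key : ∀ c : ℂ, (∀ θ ∈ Set.Ioo (0 : ℝ) (2 * Real.pi), 0 ≤ (c * grunwaldSymbol α θ).re) →
      0 ≤ (c * (p + q * Complex.I)).re := by
    intro c hc
    have h := re_mul_integral_nonneg hF (c := c) (show (0 : ℝ) ≤ 2 * Real.pi by positivity) (by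
      intro θ hθ
      rw [← mul_assoc, Complex.re_mul_ofReal]
      exact mul_nonneg (hc θ hθ) (Complex.normSq_nonneg _))
    rw [integral_grunwaldSymbol_mul_normSq hα0, hz, sum_conj_mul_mul, mul_left_comm,
      show (2 * (Real.pi : ℂ)) = ((2 * Real.pi : ℝ) : ℂ) by push_cast; rfl,
      Complex.re_ofReal_mul] at h
    exact nonneg_of_mul_nonneg_right h (by positivity)
  refine ⟨?_, abs_le.mpr ⟨?_, ?_⟩⟩
  · simpa using key 1 fun θ hθ => by
      simpa using (abs_im_grunwaldSymbol_le hα hθ.1 hθ.2).1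
  · have := key (T - Complex.I) fun θ hθ => by
      have := (abs_le.mp (abs_im_grunwaldSymbol_le hα hθ.1 hθ.2).2).1
      simp [sub_mul]
      linarith
    simp [sub_mul] at this
    linarith
  · have := key (T + Complex.I) fun θ hθ => by
      have := (abs_le.mp (abs_im_grunwaldSymbol_le hα hθ.1 hθ.2).2).2
      simp [add_mul]
      linarith
    simp [add_mul] at this
    linarith

/-! ### Symmetric pencils and the MINRES residual -/

section Pencil

open Matrix

variable {ι : Type*} [Fintype ι] [DecidableEq ι]

theorem exists_orthogonal_diagonalization {A : Matrix ι ι ℝ} (hA : A.IsSymm) :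
    ∃ (U : Matrix ι ι ℝ) (d : ι → ℝ), Uᵀ * U = 1 ∧ Uᵀ * A * U = diagonal d := by
  have hH : A.IsHermitian := by simpa [IsHermitian] using hA.eq
  refine ⟨hH.eigenvectorUnitary, hH.eigenvalues, ?_, ?_⟩
  · simpa [star_eq_conjTranspose] using Unitary.coe_star_mul_self hH.eigenvectorUnitary
  · have := hH.conjStarAlgAut_star_eigenvectorUnitary
    simpa [Unitary.conjStarAlgAut_apply, star_eq_conjTranspose, Function.comp_def] using this

/-- Rescaling orthonormal eigenvectors of `H` by the inverse square roots of its eigenvalues turns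
`H` into the identity; an orthogonal diagonalization of the transformed `K` leaves that identity
intact. -/
theorem exists_simultaneous_diagonalization {H K : Matrix ι ι ℝ} (hH : H.PosDef)
    (hK : K.IsSymm) :
    ∃ (V : Matrix ι ι ℝ) (d : ι → ℝ), Vᵀ * H * V = 1 ∧ Vᵀ * K * V = diagonal d := by
  obtain ⟨U, e, hU, hUH⟩ := exists_orthogonal_diagonalization
    (A := H) (by simpa [IsSymm] using hH.isHermitian.eq)
  have he : ∀ i, 0 < e i := by
    intro i
    have hne : U *ᵥ Pi.single i 1 ≠ 0 := by
      intro h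
      have h1 : (Uᵀ * U) *ᵥ Pi.single i 1 = 0 := by rw [← mulVec_mulVec, h, mulVec_zero]
      rw [hU, one_mulVec] at h1
      simpa using congrFun h1 i
    have hp := hH.dotProduct_mulVec_pos hne
    have h2 : star (U *ᵥ Pi.single i 1) ⬝ᵥ H *ᵥ U *ᵥ Pi.single i 1 =
        Pi.single i 1 ⬝ᵥ (Uᵀ * H * U) *ᵥ Pi.single i 1 := by
      rw [star_trivial, ← mulVec_mulVec, ← mulVec_mulVec, dotProduct_mulVec (Pi.single i 1),
        vecMul_transpose]
    rw [h2, hUH] at hp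
    simpa using hp
  set R : Matrix ι ι ℝ := diagonal fun i => (Real.sqrt (e i))⁻¹ with hR
  have hV0 : (U * R)ᵀ * H * (U * R) = 1 := by
    have : (U * R)ᵀ * H * (U * R) = R * (Uᵀ * H * U) * R := by
      rw [transpose_mul, hR, diagonal_transpose]
      simp only [Matrix.mul_assoc]
    rw [this, hUH, hR, diagonal_mul_diagonal, diagonal_mul_diagonal, ← diagonal_one]
    congr 1
    ext i
    have := Real.mul_self_sqrt (he i).le
    have := Real.sqrt_pos.mpr (he i)
    field_simp
    nlinarith
  obtain ⟨Q, d, hQ, hQK⟩ := exists_orthogonal_diagonalization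
    (A := (U * R)ᵀ * K * (U * R)) (by
      simp only [IsSymm, transpose_mul, transpose_transpose, hK.eq, Matrix.mul_assoc])
  refine ⟨U * R * Q, d, ?_, ?_⟩
  · calc (U * R * Q)ᵀ * H * (U * R * Q) = Qᵀ * ((U * R)ᵀ * H * (U * R)) * Q := by
          rw [transpose_mul (U * R)]; simp only [Matrix.mul_assoc]
      _ = 1 := by rw [hV0, Matrix.mul_one, hQ]
  · rw [← hQK, transpose_mul (U * R)]
    simp only [Matrix.mul_assoc]

theorem inv_mul_eq_of_simultaneous_diagonalization {H K V : Matrix ι ι ℝ} {d : ι → ℝ}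
    (hV : Vᵀ * H * V = 1) (hK : Vᵀ * K * V = diagonal d) :
    H⁻¹ * K = V * diagonal d * (Vᵀ * H) := by
  have h1 : V * (Vᵀ * H) = 1 := mul_eq_one_comm.mp hV
  have h2 : H * V * Vᵀ = 1 := by
    rw [mul_eq_one_comm, ← Matrix.mul_assoc, hV]
  have h3 : H⁻¹ = V * Vᵀ := inv_eq_right_inv (by rw [← Matrix.mul_assoc, h2])
  calc H⁻¹ * K = V * Vᵀ * K * (V * (Vᵀ * H)) := by rw [h3, h1, Matrix.mul_one]
    _ = V * (Vᵀ * K * V) * (Vᵀ * H) := by simp only [Matrix.mul_assoc]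
    _ = _ := by rw [hK]

theorem mulVec_col_of_simultaneous_diagonalization {H K V : Matrix ι ι ℝ} {d : ι → ℝ}
    (hV : Vᵀ * H * V = 1) (hK : Vᵀ * K * V = diagonal d) (i : ι) :
    V *ᵥ Pi.single i 1 ≠ 0 ∧
      K *ᵥ (V *ᵥ Pi.single i 1) = d i • H *ᵥ (V *ᵥ Pi.single i 1) := by
  constructor
  · intro h
    have h1 : (Vᵀ * H * V) *ᵥ Pi.single i 1 = 0 := by rw [← mulVec_mulVec, h, mulVec_zero]
    rw [hV, one_mulVec] at h1
    simpa using congrFun h1 i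
  · have h2 : H * V * Vᵀ = 1 := by rw [mul_eq_one_comm, ← Matrix.mul_assoc, hV]
    have h3 : K * V = H * V * diagonal d := by
      rw [← hK, Matrix.mul_assoc Vᵀ, ← Matrix.mul_assoc (H * V), h2, Matrix.one_mul]
    rw [mulVec_mulVec, h3, mulVec_mulVec, ← mulVec_mulVec, diagonal_mulVec_single, ← mulVec_smul]
    congr 1
    ext j
    simp [Pi.single_apply]

/-- The generalized eigenvalues of `K v = μ H v` exhaust the complex spectrum of `H⁻¹ K`. -/
theorem exists_of_mem_spectrum_inv_mul {H K : Matrix ι ι ℝ} (hH : H.PosDef) (hK : K.IsSymm)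
    {z : ℂ} (hz : z ∈ spectrum ℂ ((H⁻¹ * K).map (algebraMap ℝ ℂ))) :
    ∃ (μ : ℝ) (v : ι → ℝ), z = μ ∧ v ≠ 0 ∧ K *ᵥ v = μ • H *ᵥ v := by
  obtain ⟨V, d, hV, hVK⟩ := exists_simultaneous_diagonalization hH hK
  rw [inv_mul_eq_of_simultaneous_diagonalization hV hVK, Matrix.map_mul, Matrix.map_mul] at hz
  have hu : (Vᵀ * H).map (algebraMap ℝ ℂ) * V.map (algebraMap ℝ ℂ) = 1 := by
    rw [← Matrix.map_mul, hV, Matrix.map_one _ (map_zero _) (map_one _)]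
  let u : (Matrix ι ι ℂ)ˣ := ⟨V.map (algebraMap ℝ ℂ), (Vᵀ * H).map (algebraMap ℝ ℂ),
    mul_eq_one_comm.mp hu, hu⟩
  have hs := spectrum.units_conjugate (R := ℂ) (a := (diagonal d).map (algebraMap ℝ ℂ)) (u := u)
  rw [show (u : Matrix ι ι ℂ) = V.map (algebraMap ℝ ℂ) from rfl,
    show ((u⁻¹ : (Matrix ι ι ℂ)ˣ) : Matrix ι ι ℂ) = (Vᵀ * H).map (algebraMap ℝ ℂ) from rfl] at hs
  rw [hs, diagonal_map (map_zero _), spectrum_diagonal] at hz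
  obtain ⟨i, rfl⟩ := hz
  obtain ⟨h1, h2⟩ := mulVec_col_of_simultaneous_diagonalization hV hVK i
  exact ⟨d i, _, rfl, h1, h2⟩

theorem aeval_conj_diagonal {V W : Matrix ι ι ℝ} (hWV : W * V = 1) (d : ι → ℝ)
    (p : Polynomial ℝ) :
    Polynomial.aeval (V * diagonal d * W) p = V * diagonal (fun i => p.eval (d i)) * W := by
  have hVW : V * W = 1 := mul_eq_one_comm.mp hWV
  induction p using Polynomial.induction_on' with
  | add p q hp hq =>
    rw [map_add, hp, hq, ← Matrix.add_mul, ← Matrix.mul_add, diagonal_add]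
    simp
  | monomial n a =>
    have hpow : (V * diagonal d * W) ^ n = V * diagonal (fun i => d i ^ n) * W := by
      induction n with
      | zero => simp [hVW]
      | succ n ih =>
        rw [pow_succ, ih]
        calc V * diagonal (fun i => d i ^ n) * W * (V * diagonal d * W)
            = V * (diagonal (fun i => d i ^ n) * (W * V) * diagonal d) * W := by
              simp only [Matrix.mul_assoc]
          _ = _ := by
              rw [hWV, Matrix.mul_one, diagonal_mul_diagonal]
              simp only [pow_succ]
    have hd : (diagonal fun i => a * d i ^ n) = a • diagonal fun i => d i ^ n := by
      ext i j
      by_cases h : i = j <;> simp [h]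
    simp only [Polynomial.aeval_monomial, Polynomial.eval_monomial, hpow, hd]
    rw [Algebra.algebraMap_eq_smul_one]
    simp

/-- In the coordinates `Vᵀ H r` the energy norm is Euclidean and `p(H⁻¹ K)` multiplies the `i`-th
coordinate by `p(d i)`. -/
theorem energyNorm_aeval_le {H K : Matrix ι ι ℝ} (hH : H.PosDef) (hK : K.IsSymm)
    (p : Polynomial ℝ) {C : ℝ}
    (hp : ∀ (μ : ℝ) (v : ι → ℝ), v ≠ 0 → K *ᵥ v = μ • H *ᵥ v → |p.eval μ| ≤ C) (hC : 0 ≤ C)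
    (r : ι → ℝ) :
    energyNorm H (Polynomial.aeval (H⁻¹ * K) p *ᵥ r) ≤ C * energyNorm H r := by
  obtain ⟨V, d, hV, hVK⟩ := exists_simultaneous_diagonalization hH hK
  have hVW : V * (Vᵀ * H) = 1 := mul_eq_one_comm.mp hV
  have hn : ∀ c : ι → ℝ, (V *ᵥ c) ⬝ᵥ H *ᵥ (V *ᵥ c) = ∑ i, c i ^ 2 := by
    intro c
    have : (V *ᵥ c) ⬝ᵥ H *ᵥ (V *ᵥ c) = c ⬝ᵥ (Vᵀ * H * V) *ᵥ c := by
      rw [← mulVec_mulVec, ← mulVec_mulVec, dotProduct_mulVec c, vecMul_transpose]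
    rw [this, hV, one_mulVec]
    simp [dotProduct, sq]
  set c := (Vᵀ * H) *ᵥ r with hc
  have hr : r = V *ᵥ c := by rw [hc, mulVec_mulVec, hVW, one_mulVec]
  have hpr : Polynomial.aeval (H⁻¹ * K) p *ᵥ r = V *ᵥ fun i => p.eval (d i) * c i := by
    rw [inv_mul_eq_of_simultaneous_diagonalization hV hVK, aeval_conj_diagonal hV,
      ← mulVec_mulVec, ← mulVec_mulVec]
    congr 1
    ext i
    simp [mulVec_diagonal, hc]
  rw [hpr, energyNorm, hn, hr, energyNorm, hn]
  refine Real.sqrt_le_iff.mpr ⟨by positivity, ?_⟩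
  rw [mul_pow, Real.sq_sqrt (by positivity), Finset.mul_sum]
  refine Finset.sum_le_sum fun i _ => ?_
  obtain ⟨h1, h2⟩ := mulVec_col_of_simultaneous_diagonalization hV hVK i
  rw [mul_pow, ← sq_abs (p.eval (d i))]
  have := hp _ _ h1 h2
  gcongr

theorem aeval_mulVec_mem_krylov (M : Matrix ι ι ℝ) (z : ι → ℝ) {k : ℕ} {s : Polynomial ℝ}
    (hs : s.degree < k) : Polynomial.aeval M s *ᵥ z ∈ krylov M z k := by
  rw [Polynomial.aeval_eq_sum_range, sum_mulVec]
  refine Submodule.sum_mem _ fun j _ => ?_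
  rw [smul_mulVec]
  by_cases hj : j < k
  · exact Submodule.smul_mem _ _ (Submodule.subset_span ⟨⟨j, hj⟩, rfl⟩)
  · rw [(Polynomial.degree_lt_iff_coeff_zero s k).mp hs j (not_lt.mp hj), zero_smul]
    exact Submodule.zero_mem _

theorem precondResidual_add (P K : Matrix ι ι ℝ) (c u w : ι → ℝ) :
    precondResidual P K c (u + w) = precondResidual P K c u - (P⁻¹ * K) *ᵥ w := by
  simp only [precondResidual, mulVec_add]
  abel

/-- Every polynomial of degree at most `k` with constant term `1` is the residual polynomial of some
competitor in the Krylov space. -/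
theorem energyNorm_minres_le {H K : Matrix ι ι ℝ} (hH : H.PosDef) (hK : K.IsSymm)
    {c u₀ u : ι → ℝ} {k : ℕ} (hu : IsMinresIterate H K c u₀ k u)
    {p : Polynomial ℝ} (hp0 : p.coeff 0 = 1) (hpk : p.natDegree ≤ k) {C : ℝ} (hC : 0 ≤ C)
    (hp : ∀ (μ : ℝ) (v : ι → ℝ), v ≠ 0 → K *ᵥ v = μ • H *ᵥ v → |p.eval μ| ≤ C) :
    energyNorm H (precondResidual H K c u) ≤ C * energyNorm H (precondResidual H K c u₀) := by
  set z := precondResidual H K c u₀ with hz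
  -- With `p = 1 + X q`, the correction `w = -q(M) z`, where `M = H⁻¹ K`, has residual `z - M w =
  -- p(M) z`.
  set w := Polynomial.aeval (H⁻¹ * K) (-p.divX) *ᵥ z with hw
  have hmem : (u₀ + w) - u₀ ∈ krylov (H⁻¹ * K) z k := by
    rw [add_sub_cancel_left]
    refine aeval_mulVec_mem_krylov _ _ ?_
    rw [Polynomial.degree_neg]
    -- For constant `p` the quotient is `0`, of degree `⊥`; this covers `k = 0`.
    rcases eq_or_ne p.divX 0 with h | h
    · rw [h, Polynomial.degree_zero]; exact WithBot.bot_lt_coe k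
    · rw [← Polynomial.natDegree_lt_iff_degree_lt h, Polynomial.natDegree_divX_eq_natDegree_tsub_one]
      have : p.natDegree ≠ 0 := by
        intro h0
        exact h (by rw [Polynomial.eq_C_of_natDegree_eq_zero h0, Polynomial.divX_C])
      omega
  refine (hu.2 _ hmem).trans ?_
  have hres : precondResidual H K c (u₀ + w) = Polynomial.aeval (H⁻¹ * K) p *ᵥ z := by
    conv_rhs => rw [← Polynomial.X_mul_divX_add p, hp0]
    rw [precondResidual_add, hw, ← hz]
    simp [add_mulVec, neg_mulVec, mulVec_neg, add_comm]
  rw [hres]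
  exact energyNorm_aeval_le hH hK p hp hC z

end Pencil

/-! ### Chebyshev polynomials on two symmetric intervals -/

section Chebyshev

open Polynomial

theorem eval_chebyshev_T_half_add_inv {q : ℝ} (hq : q ≠ 0) (m : ℕ) :
    (Chebyshev.T ℝ m).eval ((q + q⁻¹) / 2) = (q ^ m + (q⁻¹) ^ m) / 2 := by
  induction m using Nat.twoStepInduction with
  | zero => simp
  | one => simp
  | more m h0 h1 =>
    push_cast at h1 ⊢
    rw [Chebyshev.T_add_two, eval_sub, eval_mul, h1, h0]
    simp only [eval_mul, eval_X, eval_ofNat]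
    linear_combination (q ^ m + q⁻¹ ^ m) / 2 * mul_inv_cancel₀ hq

/-- The affine map `s ↦ c₀ - e s` carries `[1, (1+ε)²]` onto `[-1, 1]` and `0` to `c₀ = (q + q⁻¹)/2`
with `q = ω² = ε/(2+ε)`. So `T_m(c₀ - e μ²) / T_m(c₀)` is `1` at `0` and at most `1 / T_m(c₀) ≤ 2
q^m` on the intervals. -/
theorem exists_poly_small_on_symmetric_intervals {ε : ℝ} (hε : 0 ≤ ε) (m : ℕ) :
    ∃ p : ℝ[X], p.coeff 0 = 1 ∧ p.natDegree ≤ 2 * m ∧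
      ∀ μ : ℝ, 1 ≤ μ ^ 2 → μ ^ 2 ≤ (1 + ε) ^ 2 → |p.eval μ| ≤ 2 * rate ε ^ (2 * m) := by
  have hrate : rate ε ^ (2 * m) = (ε / (2 + ε)) ^ m := by
    rw [rate, pow_mul, Real.sq_sqrt (by positivity)]
  rw [hrate]
  rcases hε.eq_or_lt with rfl | hε
  · rcases Nat.eq_zero_or_pos m with rfl | hm
    · exact ⟨1, by simp, by simp, fun μ _ _ => by simp⟩
    · refine ⟨1 - X ^ 2, by simp, ?_, fun μ h1 h2 => ?_⟩
      · refine (natDegree_sub_le _ _).trans ?_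
        simp
        omega
      · have : μ ^ 2 = 1 := by linarith
        simp [this]
  · set q := ε / (2 + ε) with hq
    have hq0 : 0 < q := by positivity
    have hbpos : 0 < (1 + ε) ^ 2 - 1 := by nlinarith
    set e := 2 / ((1 + ε) ^ 2 - 1) with he
    set c₀ := (q + q⁻¹) / 2 with hc₀
    have hc : c₀ = 1 + e := by
      rw [hc₀, he, hq]
      field_simp
      ring
    have hT : (Chebyshev.T ℝ m).eval c₀ = (q ^ m + (q⁻¹) ^ m) / 2 :=
      eval_chebyshev_T_half_add_inv hq0.ne' m
    have hTpos : 0 < (Chebyshev.T ℝ m).eval c₀ := by rw [hT]; positivity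
    refine ⟨C ((Chebyshev.T ℝ m).eval c₀)⁻¹ * (Chebyshev.T ℝ m).comp (C c₀ - C e * X ^ 2),
      ?_, ?_, fun μ h1 h2 => ?_⟩
    · rw [coeff_zero_eq_eval_zero]
      simp [eval_comp, hTpos.ne']
    · refine (natDegree_C_mul_le _ _).trans ?_
      rw [natDegree_comp, mul_comm]
      have : (C c₀ - C e * X ^ 2).natDegree ≤ 2 := by
        refine (natDegree_sub_le _ _).trans ?_
        simp [natDegree_C_mul_X_pow_le]
      have h3 : (Chebyshev.T ℝ m).natDegree ≤ m := by simp
      exact Nat.mul_le_mul this h3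
    · have habs : |c₀ - e * μ ^ 2| ≤ 1 := by
        have he2 : e * ((1 + ε) ^ 2 - 1) = 2 := by rw [he]; field_simp
        have he0 : 0 < e := by positivity
        rw [hc, abs_le]
        constructor <;> nlinarith
      have := Chebyshev.abs_eval_T_real_le_one m habs
      simp only [eval_mul, eval_C, eval_comp, eval_sub, eval_pow, eval_X]
      rw [abs_mul, abs_of_pos (inv_pos.mpr hTpos)]
      calc _ ≤ ((Chebyshev.T ℝ m).eval c₀)⁻¹ * 1 := by gcongr
        _ ≤ ((q⁻¹) ^ m / 2)⁻¹ := by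
            rw [mul_one, hT]
            gcongr
            linarith [pow_pos hq0 m]
        _ = 2 * q ^ m := by
            rw [inv_pow]
            field_simp

end Chebyshev

/-! ### Sectoriality and flip symmetry of the scheme matrix -/

open Matrix

/-- The numerical range of `B` lies in the sector `|Im z| ≤ T Re z`, expressed through the real and
imaginary parts of the vectors. -/
def HasSectorialForm {ι : Type*} [Fintype ι] (T : ℝ) (B : Matrix ι ι ℝ) : Prop :=
  ∀ x y : ι → ℝ, 0 ≤ x ⬝ᵥ B *ᵥ x + y ⬝ᵥ B *ᵥ y ∧
    |x ⬝ᵥ B *ᵥ y - y ⬝ᵥ B *ᵥ x| ≤ T * (x ⬝ᵥ B *ᵥ x + y ⬝ᵥ B *ᵥ y)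

theorem HasSectorialForm.nonneg {ι : Type*} [Fintype ι] {T : ℝ} {B : Matrix ι ι ℝ}
    (h : HasSectorialForm T B) (x : ι → ℝ) : 0 ≤ x ⬝ᵥ B *ᵥ x := by
  simpa using (h x 0).1

section Grid

variable {d : ℕ} {n : Fin d → ℕ}

theorem inDirection_piSplitAt (i : Fin d) (B : Matrix (Fin (n i)) (Fin (n i)) ℝ)
    (p q : Fin (n i) × ((j : { j // j ≠ i }) → Fin (n j))) :
    inDirection i B ((Equiv.piSplitAt i fun j => Fin (n j)).symm p)
      ((Equiv.piSplitAt i fun j => Fin (n j)).symm q) = if p.2 = q.2 then B p.1 q.1 else 0 := by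
  rw [inDirection, kroneckerProd, Matrix.of_apply]
  split_ifs with h
  · rw [Finset.prod_eq_single i]
    · simp
    · intro j _ hj
      simp [hj, h]
    · simp
  · obtain ⟨j, hj⟩ := Function.ne_iff.mp h
    refine Finset.prod_eq_zero (Finset.mem_univ j.1) ?_
    rw [Function.update_of_ne j.2]
    refine Matrix.one_apply_ne ?_
    simpa [j.2] using hj

/-- With coordinate `i` split off, `inDirection i B` is block diagonal with one copy of `B` per
choice `c` of the other coordinates. Form inequalities for `B` therefore pass to it by summation. -/
theorem dotProduct_inDirection_mulVec (i : Fin d) (B : Matrix (Fin (n i)) (Fin (n i)) ℝ)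
    (x y : Grid n → ℝ) :
    x ⬝ᵥ inDirection i B *ᵥ y = ∑ c : (j : { j // j ≠ i }) → Fin (n j),
      (fun s => x ((Equiv.piSplitAt i fun j => Fin (n j)).symm (s, c))) ⬝ᵥ
        B *ᵥ fun s => y ((Equiv.piSplitAt i fun j => Fin (n j)).symm (s, c)) := by
  simp only [dotProduct, mulVec]
  rw [← (Equiv.piSplitAt i fun j => Fin (n j)).symm.sum_comp, Fintype.sum_prod_type_right]
  refine Finset.sum_congr rfl fun c _ => Finset.sum_congr rfl fun s _ => ?_
  rw [← (Equiv.piSplitAt i fun j => Fin (n j)).symm.sum_comp, Fintype.sum_prod_type_right,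
    Finset.sum_eq_single c]
  · simp only [inDirection_piSplitAt, if_true]
  · intro c' _ hc
    simp [inDirection_piSplitAt, hc.symm]
  · simp

theorem HasSectorialForm.inDirection {T : ℝ} {i : Fin d} {B : Matrix (Fin (n i)) (Fin (n i)) ℝ}
    (h : HasSectorialForm T B) : HasSectorialForm T (inDirection i B) := by
  intro x y
  simp only [dotProduct_inDirection_mulVec, ← Finset.sum_add_distrib, ← Finset.sum_sub_distrib,
    Finset.mul_sum]
  exact ⟨Finset.sum_nonneg fun c _ => (h _ _).1,
    (Finset.abs_sum_le_sum_abs _ _).trans (Finset.sum_le_sum fun c _ => (h _ _).2)⟩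

/-- Reversal of every coordinate of a multi-index. -/
def gridRev (j : Grid n) : Grid n := fun i => (j i).rev

@[simp]
theorem gridRev_gridRev (j : Grid n) : gridRev (gridRev j) = j := by
  ext i
  simp [gridRev]

theorem multiAntiIdentity_apply (j l : Grid n) :
    multiAntiIdentity n j l = if l = gridRev j then 1 else 0 := by
  have h : ∀ i, antiIdentity (n i) (j i) (l i) = if l i = (j i).rev then 1 else 0 := by
    intro i
    simp only [antiIdentity, Matrix.of_apply, Fin.ext_iff, Fin.val_rev]
    congr 1
    apply propext
    omega
  simp only [multiAntiIdentity, kroneckerProd, Matrix.of_apply, h, Finset.prod_ite_zero]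
  simp [funext_iff, gridRev]

theorem multiAntiIdentity_mulVec (x : Grid n → ℝ) (j : Grid n) :
    (multiAntiIdentity n *ᵥ x) j = x (gridRev j) := by
  simp [mulVec, dotProduct, multiAntiIdentity_apply]

theorem multiAntiIdentity_mul (A : Matrix (Grid n) (Grid n) ℝ) (j l : Grid n) :
    (multiAntiIdentity n * A) j l = A (gridRev j) l := by
  simp [Matrix.mul_apply, multiAntiIdentity_apply]

/-- Entries depend only on `j - l`, and reversing both indices negates this difference. -/
theorem grunwaldMatrix_rev (α : ℝ) {m : ℕ} (j l : Fin m) :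
    grunwaldMatrix α m j.rev l.rev = grunwaldMatrix α m l j := by
  simp only [grunwaldMatrix, Matrix.of_apply, Fin.val_rev]
  by_cases h : (j : ℕ) ≤ (l : ℕ) + 1
  · rw [if_pos (by omega), if_pos h]
    congr 2
    omega
  · rw [if_neg (by omega), if_neg h]

theorem inDirection_gridRev {i : Fin d} {B : Matrix (Fin (n i)) (Fin (n i)) ℝ}
    (hB : ∀ j l, B j.rev l.rev = B l j) (j l : Grid n) :
    inDirection i B (gridRev j) (gridRev l) = inDirection i B l j := by
  simp only [inDirection, kroneckerProd, Matrix.of_apply]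
  refine Finset.prod_congr rfl fun k _ => ?_
  rcases eq_or_ne k i with rfl | hk
  · simpa [gridRev] using hB _ _
  · simp [hk, gridRev, Matrix.one_apply, eq_comm]

/-- Entrywise form of `Y A Y = Aᵀ`, the source both of the symmetry of `Y A` and of the commutation
of `Y` with the symmetric part. -/
theorem schemeMatrix_gridRev (α dp dm : Fin d → ℝ) (τ : ℝ) (a b : Fin d → ℝ) (j l : Grid n) :
    schemeMatrix α dp dm τ a b n (gridRev j) (gridRev l) = schemeMatrix α dp dm τ a b n l j := by
  have h1 : (1 : Matrix (Grid n) (Grid n) ℝ) (gridRev j) (gridRev l) =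
      (1 : Matrix (Grid n) (Grid n) ℝ) l j := by
    have : gridRev j = gridRev l ↔ l = j :=
      ⟨fun h => by rw [← gridRev_gridRev l, ← h, gridRev_gridRev], fun h => by rw [h]⟩
    simp [Matrix.one_apply, this]
  simp only [schemeMatrix, Matrix.add_apply, Matrix.smul_apply, Matrix.sum_apply,
    Matrix.transpose_apply, inDirection_gridRev (grunwaldMatrix_rev _), h1]

theorem dotProduct_schemeMatrix_mulVec (α dp dm : Fin d → ℝ) (τ : ℝ) (a b : Fin d → ℝ)
    (x y : Grid n → ℝ) :
    x ⬝ᵥ schemeMatrix α dp dm τ a b n *ᵥ y = 1 / τ * (x ⬝ᵥ y) +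
      ∑ i, (dp i / stepSize a b n i ^ α i *
          (x ⬝ᵥ inDirection i (grunwaldMatrix (α i) (n i)) *ᵥ y) +
        dm i / stepSize a b n i ^ α i *
          (y ⬝ᵥ inDirection i (grunwaldMatrix (α i) (n i)) *ᵥ x)) := by
  have ht : ∀ B : Matrix (Grid n) (Grid n) ℝ, x ⬝ᵥ Bᵀ *ᵥ y = y ⬝ᵥ B *ᵥ x := by
    intro B
    rw [mulVec_transpose, dotProduct_comm, dotProduct_mulVec]
  rw [schemeMatrix, add_mulVec, sum_mulVec, dotProduct_add, dotProduct_sum, smul_mulVec,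
    one_mulVec, dotProduct_smul, smul_eq_mul]
  simp only [add_mulVec, smul_mulVec, dotProduct_add, dotProduct_smul, smul_eq_mul, ht]

theorem stepSize_rpow_pos {a b : Fin d → ℝ} (hab : ∀ i, a i < b i) (α : ℝ) (i : Fin d) :
    0 < stepSize a b n i ^ α := by
  refine Real.rpow_pos_of_pos (div_pos (sub_pos.mpr (hab i)) ?_) _
  positivity

theorem hasSectorialForm_inDirection_grunwaldMatrix {α : ℝ} (hα : 1 < α ∧ α < 2) (i : Fin d) :
    HasSectorialForm |Real.tan (α / 2 * Real.pi)|
      (inDirection (n := n) i (grunwaldMatrix α (n i))) :=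
  HasSectorialForm.inDirection fun x y => grunwaldMatrix_form_bound hα x y

variable {α dp dm : Fin d → ℝ} {τ : ℝ} {a b : Fin d → ℝ}

theorem schemeMatrix_form_pos (hα : ∀ i, 1 < α i ∧ α i < 2) (hdp : ∀ i, 0 ≤ dp i)
    (hdm : ∀ i, 0 ≤ dm i) (hτ : 0 < τ) (hab : ∀ i, a i < b i) {x : Grid n → ℝ} (hx : x ≠ 0) :
    0 < x ⬝ᵥ schemeMatrix α dp dm τ a b n *ᵥ x := by
  rw [dotProduct_schemeMatrix_mulVec]
  have hxx : 0 < x ⬝ᵥ x := by simpa using dotProduct_star_self_pos_iff.mpr hx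
  refine add_pos_of_pos_of_nonneg (by positivity) (Finset.sum_nonneg fun i _ => ?_)
  have h := (hasSectorialForm_inDirection_grunwaldMatrix (n := n) (hα i) i).nonneg x
  have := stepSize_rpow_pos (n := n) hab (α i) i
  have := hdp i
  have := hdm i
  positivity

theorem asymmetryBound_nonneg (hsum : ∀ i, 0 < dp i + dm i) : 0 ≤ asymmetryBound α dp dm :=
  Real.iSup_nonneg fun i => mul_nonneg (div_nonneg (abs_nonneg _) (hsum i).le) (abs_nonneg _)

/-- Direction `i` contributes `(d₊ + d₋) p` to the real part and `(d₊ - d₋) q` to the imaginary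
part, both over `h^α`, with `|q| ≤ |tan| p`. The time-step term is real and nonnegative, so it only
helps. -/
theorem hasSectorialForm_schemeMatrix (hα : ∀ i, 1 < α i ∧ α i < 2)
    (hsum : ∀ i, 0 < dp i + dm i) (hτ : 0 < τ) (hab : ∀ i, a i < b i) :
    HasSectorialForm (asymmetryBound α dp dm) (schemeMatrix α dp dm τ a b n) := by
  intro x y
  have hT := asymmetryBound_nonneg (α := α) hsum
  set t := asymmetryBound α dp dm
  set W := fun i => inDirection i (grunwaldMatrix (α i) (n i))
  set s := fun i => stepSize a b n i ^ α i
  set p := fun i => x ⬝ᵥ W i *ᵥ x + y ⬝ᵥ W i *ᵥ y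
  set q := fun i => x ⬝ᵥ W i *ᵥ y - y ⬝ᵥ W i *ᵥ x
  have hp : ∀ i, 0 ≤ p i := fun i => (hasSectorialForm_inDirection_grunwaldMatrix (hα i) i x y).1
  have hq : ∀ i, |q i| ≤ |Real.tan (α i / 2 * Real.pi)| * p i := fun i =>
    (hasSectorialForm_inDirection_grunwaldMatrix (hα i) i x y).2
  have hs : ∀ i, 0 < s i := fun i => stepSize_rpow_pos hab (α i) i
  have hre : x ⬝ᵥ schemeMatrix α dp dm τ a b n *ᵥ x + y ⬝ᵥ schemeMatrix α dp dm τ a b n *ᵥ y =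
      1 / τ * (x ⬝ᵥ x + y ⬝ᵥ y) + ∑ i, (dp i + dm i) / s i * p i := by
    rw [dotProduct_schemeMatrix_mulVec, dotProduct_schemeMatrix_mulVec, add_add_add_comm,
      ← mul_add, ← Finset.sum_add_distrib]
    congr 1
    refine Finset.sum_congr rfl fun i _ => ?_
    simp only [p, W, s]
    ring
  have him : x ⬝ᵥ schemeMatrix α dp dm τ a b n *ᵥ y - y ⬝ᵥ schemeMatrix α dp dm τ a b n *ᵥ x =
      ∑ i, (dp i - dm i) / s i * q i := by
    rw [dotProduct_schemeMatrix_mulVec, dotProduct_schemeMatrix_mulVec, dotProduct_comm y x,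
      add_sub_add_left_eq_sub, ← Finset.sum_sub_distrib]
    refine Finset.sum_congr rfl fun i _ => ?_
    simp only [q, W, s]
    ring
  have hxy : 0 ≤ 1 / τ * (x ⬝ᵥ x + y ⬝ᵥ y) := by
    have h1 : 0 ≤ x ⬝ᵥ x := by simpa using dotProduct_star_self_nonneg x
    have h2 : 0 ≤ y ⬝ᵥ y := by simpa using dotProduct_star_self_nonneg y
    positivity
  have hterm : ∀ i, |(dp i - dm i) / s i * q i| ≤ t * ((dp i + dm i) / s i * p i) := by
    intro i
    have hi : |dp i - dm i| / (dp i + dm i) * |Real.tan (α i / 2 * Real.pi)| ≤ t :=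
      le_ciSup (f := fun i => |dp i - dm i| / (dp i + dm i) * |Real.tan (α i / 2 * Real.pi)|)
        (Set.finite_range _).bddAbove i
    have hsi := hs i
    have hpi := hp i
    have hdi := hsum i
    calc |(dp i - dm i) / s i * q i| = |dp i - dm i| / s i * |q i| := by
          rw [abs_mul, abs_div, abs_of_pos hsi]
      _ ≤ |dp i - dm i| / s i * (|Real.tan (α i / 2 * Real.pi)| * p i) := by
          gcongr
          exact hq i
      _ = |dp i - dm i| / (dp i + dm i) * |Real.tan (α i / 2 * Real.pi)| *
            ((dp i + dm i) / s i * p i) := by field_simp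
      _ ≤ _ := by gcongr
  have hsum0 : 0 ≤ ∑ i, (dp i + dm i) / s i * p i := Finset.sum_nonneg fun i _ =>
    mul_nonneg (div_nonneg (hsum i).le (hs i).le) (hp i)
  rw [hre, him]
  refine ⟨add_nonneg hxy hsum0, ?_⟩
  calc |∑ i, (dp i - dm i) / s i * q i| ≤ ∑ i, t * ((dp i + dm i) / s i * p i) :=
        (Finset.abs_sum_le_sum_abs _ _).trans (Finset.sum_le_sum fun i _ => hterm i)
    _ = t * ∑ i, (dp i + dm i) / s i * p i := by rw [Finset.mul_sum]
    _ ≤ _ := by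
        gcongr
        exact le_add_of_nonneg_left hxy

end Grid

/-! ### Eigenvalue bounds for the flipped matrix -/

section SymmetricPart

variable {ι : Type*} [Fintype ι]

theorem dotProduct_symmPart_mulVec (A : Matrix ι ι ℝ) (x y : ι → ℝ) :
    x ⬝ᵥ symmPart A *ᵥ y = (x ⬝ᵥ A *ᵥ y + y ⬝ᵥ A *ᵥ x) / 2 := by
  have ht : x ⬝ᵥ Aᵀ *ᵥ y = y ⬝ᵥ A *ᵥ x := by
    rw [mulVec_transpose, dotProduct_comm, dotProduct_mulVec]
  rw [symmPart, smul_mulVec, add_mulVec, dotProduct_smul, dotProduct_add, ht, smul_eq_mul]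
  ring

theorem posDef_symmPart {A : Matrix ι ι ℝ} (h : ∀ x : ι → ℝ, x ≠ 0 → 0 < x ⬝ᵥ A *ᵥ x) :
    (symmPart A).PosDef := by
  refine PosDef.of_dotProduct_mulVec_pos ?_ fun x hx => ?_
  · ext i j
    simp only [symmPart, conjTranspose_apply, Matrix.smul_apply, Matrix.add_apply, transpose_apply,
      star_trivial, add_comm]
  · rw [star_trivial, dotProduct_symmPart_mulVec]
    linarith [h x hx]

/-- Bounds for the generalized eigenvalues of `Y A v = μ H v`, where `H` is the symmetric part
of `A` and `Y` the permutation matrix of the involution `σ` with `Y A Y = Aᵀ`. -/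
theorem sq_bounds_of_flipped_eigenvector {A : Matrix ι ι ℝ} {t : ℝ} (ht : 0 ≤ t)
    (hA : HasSectorialForm t A) (hpos : ∀ x : ι → ℝ, x ≠ 0 → 0 < x ⬝ᵥ A *ᵥ x)
    {σ : ι → ι} (hσ : Function.Involutive σ) (hAσ : ∀ j l, A (σ j) (σ l) = A l j)
    {μ : ℝ} {v : ι → ℝ} (hv : v ≠ 0)
    (hμ : ∀ j, (A *ᵥ v) (σ j) = μ * (symmPart A *ᵥ v) j) :
    1 ≤ μ ^ 2 ∧ μ ^ 2 ≤ 1 + t ^ 2 := by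
  set H := symmPart A with hH
  set g : ι → ℝ := fun j => v (σ j) with hg
  have hHσ : ∀ j l, H (σ j) (σ l) = H j l := by
    intro j l
    simp [hH, symmPart, hAσ, add_comm]
  have hHg : ∀ j, (H *ᵥ g) j = (H *ᵥ v) (σ j) := by
    intro j
    simp only [mulVec, dotProduct, hg]
    rw [← Equiv.sum_comp (hσ.toPerm σ) fun l => H (σ j) l * v l]
    simp [hHσ]
  have hAv : A *ᵥ v = μ • H *ᵥ g := by
    ext j
    rw [Pi.smul_apply, smul_eq_mul, hHg, ← hμ, hσ j]
  have hgg : g ⬝ᵥ H *ᵥ g = v ⬝ᵥ H *ᵥ v := by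
    simp only [dotProduct, hHg]
    exact Equiv.sum_comp (hσ.toPerm σ) fun j => v j * (H *ᵥ v) j
  have hf : ∀ x, x ⬝ᵥ A *ᵥ v = μ * (x ⬝ᵥ H *ᵥ g) := fun x => by
    rw [hAv, dotProduct_smul, smul_eq_mul]
  have hsymm : ∀ x y, x ⬝ᵥ H *ᵥ y = y ⬝ᵥ H *ᵥ x := fun x y => by
    rw [hH, dotProduct_symmPart_mulVec, dotProduct_symmPart_mulVec, add_comm]
  have hdiag : ∀ x, x ⬝ᵥ H *ᵥ x = x ⬝ᵥ A *ᵥ x := fun x => by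
    rw [hH, dotProduct_symmPart_mulVec]; ring
  have ha := hpos v hv
  -- Since `A v = μ H g`, this is `w = H⁻¹ S v` with `S = A - H` skew. Hence `w` is `H`-orthogonal
  -- to `v`, and its energy is `μ² - 1` times that of `v`, because `g` and `v` have equal energy.
  set w := μ • g - v with hw
  have hvg : v ⬝ᵥ A *ᵥ v = μ * (g ⬝ᵥ H *ᵥ v) := by rw [hf, hsymm]
  have hww : w ⬝ᵥ A *ᵥ w = (μ ^ 2 - 1) * (v ⬝ᵥ A *ᵥ v) := by
    rw [← hdiag, hw]
    simp only [mulVec_sub, mulVec_smul, dotProduct_sub, sub_dotProduct, dotProduct_smul,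
      smul_dotProduct, smul_eq_mul]
    rw [hgg, hsymm v g, hdiag v]
    linear_combination 2 * hvg
  have hwv : w ⬝ᵥ A *ᵥ v = (μ ^ 2 - 1) * (v ⬝ᵥ A *ᵥ v) := by
    rw [hf, hw]
    simp only [sub_dotProduct, smul_dotProduct, smul_eq_mul]
    rw [hgg, hsymm v g, hdiag v]
    linear_combination hvg
  have hwv0 : w ⬝ᵥ H *ᵥ v = 0 := by
    rw [hw]
    simp only [sub_dotProduct, smul_dotProduct, smul_eq_mul]
    rw [hdiag v]
    linear_combination -hvg
  have hvw : v ⬝ᵥ A *ᵥ w = -((μ ^ 2 - 1) * (v ⬝ᵥ A *ᵥ v)) := by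
    have := dotProduct_symmPart_mulVec A w v
    rw [← hH, hwv0, hwv] at this
    linarith
  set a := v ⬝ᵥ A *ᵥ v
  have hb : 0 ≤ (μ ^ 2 - 1) * a := hww ▸ hA.nonneg w
  have h1 : 1 ≤ μ ^ 2 := by
    have := nonneg_of_mul_nonneg_left hb ha
    linarith
  refine ⟨h1, ?_⟩
  -- Sectoriality at the pair `(c w, v)`, whose skew term is `2c(μ² - 1)a`. The choice `c = 1/t`
  -- gives `μ² - 1 ≤ t²`; for `t = 0`, `c = 1` already forces `μ² ≤ 1`.
  have hsec : ∀ c : ℝ, 2 * c * ((μ ^ 2 - 1) * a) ≤ t * (c ^ 2 * ((μ ^ 2 - 1) * a) + a) := by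
    intro c
    have := (le_abs_self _).trans (hA (c • w) v).2
    simp only [mulVec_smul, dotProduct_smul, smul_dotProduct, smul_eq_mul] at this
    rw [hww, hwv, hvw] at this
    linarith
  have hle : (μ ^ 2 - 1) * a ≤ t ^ 2 * a := by
    rcases ht.eq_or_lt with rfl | ht
    · have := hsec 1
      linarith
    · have h := hsec t⁻¹
      have e1 : 2 * t⁻¹ * ((μ ^ 2 - 1) * a) = (2 * ((μ ^ 2 - 1) * a)) / t := by
        field_simp
      have e2 : t * (t⁻¹ ^ 2 * ((μ ^ 2 - 1) * a) + a) = ((μ ^ 2 - 1) * a + t ^ 2 * a) / t := by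
        field_simp
      rw [e1, e2, div_le_div_iff_of_pos_right ht] at h
      linarith
  have := le_of_mul_le_mul_right hle ha
  linarith

end SymmetricPart

/-! ### Assembly of the main theorem -/

theorem mem_union_Icc_of_sq_bounds {ε μ : ℝ} (hε : 0 ≤ ε) (h1 : 1 ≤ μ ^ 2)
    (h2 : μ ^ 2 ≤ (1 + ε) ^ 2) : μ ∈ Set.Icc (-(1 + ε)) (-1) ∪ Set.Icc 1 (1 + ε) := by
  have hb := abs_le.mp (abs_le_of_sq_le_sq h2 (by linarith))
  have ha : 1 ≤ |μ| := by rwa [← one_le_sq_iff_one_le_abs]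
  rcases le_abs.mp ha with h | h
  · exact Or.inr ⟨h, hb.2⟩
  · exact Or.inl ⟨hb.1, by linarith⟩

theorem rate_mem_Ioo {ε : ℝ} (hε : 0 < ε) : 0 < rate ε ∧ rate ε < 1 := by
  refine ⟨Real.sqrt_pos.mpr (by positivity), ?_⟩
  rw [rate, Real.sqrt_lt' one_pos, one_pow, div_lt_one (by positivity)]
  linarith

end FirstOrderScheme

theorem mainTheorem12 (d : ℕ) (hd : 0 < d) (α dp dm : Fin d → ℝ)
    (hα : ∀ i, 1 < α i ∧ α i < 2) (hdp : ∀ i, 0 ≤ dp i) (hdm : ∀ i, 0 ≤ dm i)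
    (hsum : ∀ i, 0 < dp i + dm i) :
    ∃ ε : ℝ,
      (0 < FirstOrderScheme.asymmetryBound α dp dm →
        0 < ε ∧ ε < FirstOrderScheme.asymmetryBound α dp dm ∧
          0 < FirstOrderScheme.rate ε ∧ FirstOrderScheme.rate ε < 1) ∧
      (FirstOrderScheme.asymmetryBound α dp dm = 0 → ε = 0) ∧
      ∀ (τ : ℝ) (a b : Fin d → ℝ) (n : Fin d → ℕ),
        0 < τ → (∀ i, a i < b i) → (∀ i, 0 < n i) →
        ∀ (A Y H : Matrix (FirstOrderScheme.Grid n) (FirstOrderScheme.Grid n) ℝ),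
          A = FirstOrderScheme.schemeMatrix α dp dm τ a b n →
          Y = FirstOrderScheme.multiAntiIdentity n →
          H = FirstOrderScheme.symmPart A →
          H.PosDef ∧ (Y * A).IsSymm ∧
          (∀ z ∈ spectrum ℂ ((H⁻¹ * (Y * A)).map (algebraMap ℝ ℂ)),
            ∃ t : ℝ, z = (t : ℂ) ∧ t ∈ Set.Icc (-(1 + ε)) (-1) ∪ Set.Icc 1 (1 + ε)) ∧
          ∀ (f u₀ : FirstOrderScheme.Grid n → ℝ) (k : ℕ) (u : FirstOrderScheme.Grid n → ℝ),
            FirstOrderScheme.IsMinresIterate H (Y * A) (Y.mulVec f) u₀ k u →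
            FirstOrderScheme.energyNorm H
                (FirstOrderScheme.precondResidual H (Y * A) (Y.mulVec f) u) ≤
              2 * FirstOrderScheme.rate ε ^ (2 * (k / 2)) *
                FirstOrderScheme.energyNorm H
                  (FirstOrderScheme.precondResidual H (Y * A) (Y.mulVec f) u₀) := by
  open FirstOrderScheme Matrix in
  have ht := asymmetryBound_nonneg (α := α) hsum
  set t := asymmetryBound α dp dm with ht_def
  -- Chosen so that `(1 + ε)² = 1 + t²`; comparison with `(1 + t)²` gives `ε < t` when `t > 0`.
  set ε := Real.sqrt (1 + t ^ 2) - 1 with hε_def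
  have hε : 0 ≤ ε := by
    rw [hε_def, sub_nonneg, Real.one_le_sqrt]
    nlinarith
  have hεt : (1 + ε) ^ 2 = 1 + t ^ 2 := by
    rw [hε_def, add_sub_cancel, Real.sq_sqrt (by positivity)]
  refine ⟨ε, fun h => ?_, fun h => ?_, ?_⟩
  · have hε0 : 0 < ε := by
      rw [hε_def, sub_pos, Real.lt_sqrt zero_le_one]
      nlinarith
    exact ⟨hε0, by nlinarith, rate_mem_Ioo hε0⟩
  · rw [hε_def, h]
    simp
  · rintro τ a b n hτ hab - A Y H hA rfl rfl
    have hAσ : ∀ j l, A (gridRev j) (gridRev l) = A l j := fun j l => by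
      rw [hA, schemeMatrix_gridRev]
    have hpos : ∀ x : Grid n → ℝ, x ≠ 0 → 0 < x ⬝ᵥ A *ᵥ x := fun x hx =>
      hA ▸ schemeMatrix_form_pos hα hdp hdm hτ hab hx
    have hsec : HasSectorialForm t A :=
      hA ▸ hasSectorialForm_schemeMatrix hα hsum hτ hab
    have hH := posDef_symmPart hpos
    have hK : (multiAntiIdentity n * A).IsSymm := by
      ext j l
      rw [transpose_apply, multiAntiIdentity_mul, multiAntiIdentity_mul, ← hAσ,
        gridRev_gridRev]
    have hμ : ∀ (μ : ℝ) (v : Grid n → ℝ), v ≠ 0 →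
        (multiAntiIdentity n * A) *ᵥ v = μ • symmPart A *ᵥ v →
        1 ≤ μ ^ 2 ∧ μ ^ 2 ≤ (1 + ε) ^ 2 := by
      intro μ v hv h
      rw [hεt]
      refine sq_bounds_of_flipped_eigenvector ht hsec hpos gridRev_gridRev hAσ hv fun j => ?_
      rw [← multiAntiIdentity_mulVec (A *ᵥ v), mulVec_mulVec, h, Pi.smul_apply, smul_eq_mul]
    refine ⟨hH, hK, fun z hz => ?_, fun f u₀ k u hu => ?_⟩
    · obtain ⟨μ, v, rfl, hv, h⟩ := exists_of_mem_spectrum_inv_mul hH hK hz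
      obtain ⟨h1, h2⟩ := hμ μ v hv h
      exact ⟨μ, rfl, mem_union_Icc_of_sq_bounds hε h1 h2⟩
    -- The polynomial is even, so degree `k` only allows Chebyshev degree `⌊k/2⌋` in `μ²`.
    · obtain ⟨p, hp0, hpk, hp⟩ := exists_poly_small_on_symmetric_intervals hε (k / 2)
      refine energyNorm_minres_le hH hK hu hp0 (by omega) ?_ fun μ v hv h =>
        hp μ (hμ μ v hv h).1 (hμ μ v hv h).2
      have : 0 ≤ rate ε := Real.sqrt_nonneg _
      positivity
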